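/- Let $n\ge 2$ be an integer, $k\ge 1$ a real number, and let $P(z)=\sum_{j=0}^{n}a_jz^j$ be a polynomial with complex coefficients, of degree exactly $n$, all of whose zeros lie in $|z|\le k$. Put $m=\min_{|z|=k}|P(z)|$ and $$\phi(k)=\begin{cases}\dfrac{k^n-1}{n}-\dfrac{k^{n-2}-1}{n-2}, & n>2,\\[2mm] \dfrac{(k-1)^2}{2}, & n=2,\end{cases}\qquad \psi(k)=\begin{cases}1-\dfrac1{k^2}, & n>2,\\[2mm] 1-\dfrac1k, & n=2.\end{cases}$$ Then for every real $l$ with $0\le l<1$ we have $k^n|a_n|-lm+|a_0|>0$ and $$\begin{aligned}\max_{|z|=1}|P'(z)|\ \ge\ {}&\frac{n}{1+k^n}\Big(\max_{|z|=1}|P(z)|+lm\Big)+\psi(k)|a_1|\\ &+\frac{1}{k^n(1+k^n)}\bigg\{\frac{k^n|a_n|-lm-|a_0|}{k^n|a_n|-lm+|a_0|}\Big(k^n\max_{|z|=1}|P(z)|-lm\Big)\\ &\qquad+k^{n-1}|a_{n-1}|\,\phi(k)\bigg(n+\frac{k^n|a_n|-lm-|a_0|}{k^n|a_n|-lm+|a_0|}\bigg)\bigg\}.\end{aligned}$$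 For $l=0$ the right-hand side equals $$\frac{1}{1+k^n}\bigg(n+\frac{k^n|a_n|-|a_0|}{k^n|a_n|+|a_0|}\bigg)\max_{|z|=1}|P(z)|+\frac{|a_{n-1}|}{k(1+k^n)}\bigg(n+\frac{k^n|a_n|-|a_0|}{k^n|a_n|+|a_0|}\bigg)\phi(k)+|a_1|\psi(k).$$ The result is sharp: for all $n\ge2$ and $k\ge1$ the polynomial $P(z)=z^n+k^n$ satisfies the hypotheses, and for it equality holds in the inequality for every $0\le l<1$. -/

import Mathlib

open Polynomial

/-- `max_{|z| = r} |P(z)|` (for `r ≥ 0`). -/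
noncomputable def circleMax (P : ℂ[X]) (r : ℝ) : ℝ :=
  sSup ((fun z : ℂ => ‖P.eval z‖) '' Metric.sphere (0 : ℂ) r)

/-- `min_{|z| = r} |P(z)|` (for `r ≥ 0`). -/
noncomputable def circleMin (P : ℂ[X]) (r : ℝ) : ℝ :=
  sInf ((fun z : ℂ => ‖P.eval z‖) '' Metric.sphere (0 : ℂ) r)

/-- On a circle of radius `r ≥ 0` the maximum is attained, so `circleMax` is a true maximum. -/
theorem isGreatest_circleMax (P : ℂ[X]) {r : ℝ} (hr : 0 ≤ r) :
    IsGreatest ((fun z : ℂ => ‖P.eval z‖) '' Metric.sphere (0 : ℂ) r) (circleMax P r) :=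
  ((isCompact_sphere (0 : ℂ) r).image P.continuous.norm).isGreatest_sSup
    ((NormedSpace.sphere_nonempty.2 hr).image _)

/-- On a circle of radius `r ≥ 0` the minimum is attained, so `circleMin` is a true minimum. -/
theorem isLeast_circleMin (P : ℂ[X]) {r : ℝ} (hr : 0 ≤ r) :
    IsLeast ((fun z : ℂ => ‖P.eval z‖) '' Metric.sphere (0 : ℂ) r) (circleMin P r) :=
  ((isCompact_sphere (0 : ℂ) r).image P.continuous.norm).isLeast_sInf
    ((NormedSpace.sphere_nonempty.2 hr).image _)

/-- `φ(k) = (k^n - 1)/n - (k^(n-2) - 1)/(n-2)` if `n > 2`, and `φ(k) = (k - 1)^2/2` if `n = 2`. -/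
noncomputable def phi (n : ℕ) (k : ℝ) : ℝ :=
  if 2 < n then (k ^ n - 1) / (n : ℝ) - (k ^ (n - 2) - 1) / ((n : ℝ) - 2) else (k - 1) ^ 2 / 2

/-- `ψ(k) = 1 - 1/k^2` if `n > 2`, and `ψ(k) = 1 - 1/k` if `n = 2`. -/
noncomputable def psi (n : ℕ) (k : ℝ) : ℝ :=
  if 2 < n then 1 - 1 / k ^ 2 else 1 - 1 / k

/-- The quotient `(k^n |a_n| - l m - |a_0|) / (k^n |a_n| - l m + |a_0|)`,
with `m = min_{|z| = k} |P(z)|`. -/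
noncomputable def coeffRatio (n : ℕ) (k l : ℝ) (P : ℂ[X]) : ℝ :=
  (k ^ n * ‖P.coeff n‖ - l * circleMin P k - ‖P.coeff 0‖) /
    (k ^ n * ‖P.coeff n‖ - l * circleMin P k + ‖P.coeff 0‖)

/-- The lower bound for `max_{|z| = 1} |P'(z)|`, with `m = min_{|z| = k} |P(z)|`. -/
noncomputable def derivLowerBound (n : ℕ) (k l : ℝ) (P : ℂ[X]) : ℝ :=
  (n : ℝ) / (1 + k ^ n) * (circleMax P 1 + l * circleMin P k) + psi n k * ‖P.coeff 1‖
    + 1 / (k ^ n * (1 + k ^ n)) *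
      (coeffRatio n k l P * (k ^ n * circleMax P 1 - l * circleMin P k)
        + k ^ (n - 1) * ‖P.coeff (n - 1)‖ * phi n k * ((n : ℝ) + coeffRatio n k l P))

/-! Put f(z) = P(kz), whose zeros lie in the closed unit disc, and g(z) = z^n f(1/z), which has none
in the open disc. On the unit circle |f| and |g| have the same maximum Mk = max_{|z|=k} |P|, and the
proof eliminates Mk from three estimates.

Where |f| is maximal on the unit circle, a Turán bound with Dubinin's ratio s
(`half_mul_sub_add_le_norm_derivative`) gives |f'| ≥ (n + s)(Mk - lm)/2 + nlm. Since f'(w) = k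
P'(kw), the growth estimate `norm_eval_mul_le_psi` for P' gives |f'| ≤ k^n (max_{|z|=1} |P'| -
ψ|a_1|). Finally, the Ankeny–Rivlin bound `norm_eval_mul_le_of_no_zeros` for g on |z| = k, where |g|
takes the value k^n max_{|z|=1} |P|, bounds Mk - lm from below.

The correction ψ comes from von Neumann's inequality for a suitable unitary matrix, and φ(k) is the
integral of t^(n-1) ψ(t) over [1, k]. The terms in lm come from perturbation: g - β stays zero-free
in the open disc for |β| ≤ lm, and the argument of β is then chosen optimally. -/

theorem exists_unit_eq_norm_mul (v : ℂ) : ∃ e : ℂ, ‖e‖ = 1 ∧ v = ‖v‖ * e :=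
  ⟨Complex.exp (v.arg * Complex.I), Complex.norm_exp_ofReal_mul_I _,
    (Complex.norm_mul_exp_arg_mul_I v).symm⟩

/-- A unit complex number aligning two given complex numbers. -/
theorem exists_norm_eq_one_norm_add_mul (a b : ℂ) :
    ∃ ε : ℂ, ‖ε‖ = 1 ∧ ‖a + ε * b‖ = ‖a‖ + ‖b‖ := by
  obtain ⟨e, he, hae⟩ := exists_unit_eq_norm_mul a
  obtain ⟨e', he', hbe⟩ := exists_unit_eq_norm_mul b
  have h0 : e' ≠ 0 := by rintro rfl; simp at he'
  refine ⟨e / e', by simp [he, he'], ?_⟩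
  have h : a + e / e' * b = ((‖a‖ + ‖b‖ : ℝ) : ℂ) * e := by
    rw [hbe, hae]
    simp only [norm_mul, Complex.norm_real, norm_norm, he, he', mul_one]
    push_cast
    field_simp
  rw [h, norm_mul, he, mul_one, Complex.norm_real, Real.norm_of_nonneg (by positivity)]

/-! ### Von Neumann's inequality and a coefficient estimate -/

/-- Von Neumann's inequality for unitary operators. -/
theorem norm_aeval_le_of_mem_unitary {A : Type*} [CStarAlgebra A] {u : A} (hu : u ∈ unitary A)
    (q : ℂ[X]) {M : ℝ} (hM0 : 0 ≤ M) (hM : ∀ z : ℂ, ‖z‖ = 1 → ‖q.eval z‖ ≤ M) :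
    ‖aeval u q‖ ≤ M := by
  have : IsStarNormal u :=
    ⟨(Unitary.star_mul_self_of_mem hu).trans (Unitary.mul_star_self_of_mem hu).symm⟩
  rw [← cfc_polynomial q u]
  refine norm_cfc_le hM0 fun x hx => hM x ?_
  simpa using spectrum.subset_circle_of_unitary hu hx

open scoped InnerProductSpace in
/-- A unitary operator and a unit vector whose moments are `r ^ j` for `j < N + 2` and
`r ^ (N + 2) + ε (1 - r ^ 2)` for `j = N + 2`. -/
theorem exists_unitary_moments (N : ℕ) {r : ℝ} (hr1 : r ^ 2 ≤ 1) {ε : ℂ}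
    (hε : ‖ε‖ = 1) :
    ∃ U ∈ unitary (EuclideanSpace ℂ (Fin (N + 2)) →L[ℂ] EuclideanSpace ℂ (Fin (N + 2))),
    ∃ e : EuclideanSpace ℂ (Fin (N + 2)), ‖e‖ = 1 ∧
      (∀ j ≤ N + 1, ⟪e, (U ^ j) e⟫_ℂ = (r : ℂ) ^ j) ∧
      ⟪e, (U ^ (N + 2)) e⟫_ℂ = (r : ℂ) ^ (N + 2) + ε * (1 - (r : ℂ) ^ 2) := by
  obtain ⟨s, hs⟩ : ∃ s : ℝ, s ^ 2 = 1 - r ^ 2 := ⟨√(1 - r ^ 2), Real.sq_sqrt (by linarith)⟩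
  have hsc : (s : ℂ) ^ 2 = 1 - (r : ℂ) ^ 2 := by exact_mod_cast hs
  have hεc : (starRingEnd ℂ) ε * ε = 1 := by rw [Complex.conj_mul', hε]; norm_num
  set b := EuclideanSpace.basisFun (Fin (N + 2)) ℂ with hb
  have hbi : ∀ i j, ⟪b i, b j⟫_ℂ = if i = j then 1 else 0 :=
    fun i j => orthonormal_iff_ite.1 b.orthonormal i j
  -- `U` will send `b i` to `u (i + 1)`, indices being cyclic. From `b 0` a part `s` leaks to `b 1`,
  -- is shifted along the basis, and first returns to `b 0` after N + 2 steps in all, with weight ε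
  -- s² = ε (1 - r²).
  let u : Fin (N + 2) → EuclideanSpace ℂ (Fin (N + 2)) := fun i =>
    if i = 0 then ε • ((s : ℂ) • b 0 - (r : ℂ) • b 1)
    else if i = 1 then (r : ℂ) • b 0 + (s : ℂ) • b 1 else b i
  have h10 : (1 : Fin (N + 2)) ≠ 0 := by simp
  have hu : Orthonormal ℂ u := by
    rw [orthonormal_iff_ite]
    intro i j
    by_cases hi0 : i = 0
    · by_cases hj0 : j = 0
      · subst hi0 hj0
        simp only [u, if_true, inner_smul_left, inner_smul_right, inner_sub_left, inner_sub_right,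
          hbi, h10, h10.symm, if_false, Complex.conj_ofReal]
        linear_combination (s ^ 2 + r ^ 2 : ℂ) * hεc + hsc
      · by_cases hj1 : j = 1
        · subst hi0 hj1
          simp only [u, if_true, inner_smul_left, inner_add_right, inner_smul_right, inner_sub_left,
            hbi, h10, h10.symm, if_false, Complex.conj_ofReal]
          ring
        · subst hi0
          simp only [u, hj0, hj1, inner_smul_left, inner_sub_left, hbi, Ne.symm hj0, Ne.symm hj1,
            if_true, if_false, mul_zero, sub_zero]
    · by_cases hi1 : i = 1
      · subst hi1
        by_cases hj0 : j = 0
        · subst hj0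
          simp only [u, if_true, inner_smul_left, inner_add_left, inner_smul_right, inner_sub_right,
            hbi, h10, h10.symm, if_false, Complex.conj_ofReal]
          ring
        · by_cases hj1 : j = 1
          · subst hj1
            simp only [u, if_true, inner_smul_left, inner_add_left, inner_smul_right,
              inner_add_right, hbi, h10, h10.symm, if_false, Complex.conj_ofReal]
            linear_combination hsc
          · simp only [u, h10, hj0, hj1, inner_smul_left, inner_add_left, hbi, Ne.symm hj0, Ne.symm hj1,
              if_true, if_false, mul_zero, add_zero]
      · by_cases hj0 : j = 0
        · subst hj0
          simp only [u, hi0, hi1, inner_smul_right, inner_sub_right, hbi,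
            if_true, if_false, mul_zero, sub_zero]
        · by_cases hj1 : j = 1
          · subst hj1
            simp only [u, h10, hi0, hi1, inner_smul_right, inner_add_right, hbi,
              if_true, if_false, mul_zero, add_zero]
          · simp [u, hi0, hi1, hj0, hj1, hbi]
  let b' : OrthonormalBasis (Fin (N + 2)) ℂ (EuclideanSpace ℂ (Fin (N + 2))) :=
    (basisOfOrthonormalOfCardEqFinrank hu (by simp)).toOrthonormalBasis (by simpa using hu)
  have hb' : ∀ i, b' i = u i := fun i => by simp [b']
  let L := b.equiv b' (Equiv.addRight 1)
  let U := Unitary.linearIsometryEquiv.symm L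
  have hU : ∀ i, (U : EuclideanSpace ℂ (Fin (N + 2)) →L[ℂ] EuclideanSpace ℂ (Fin (N + 2))) (b i) = u (i + 1) := fun i => by
    have : L (b i) = u (i + 1) := by
      rw [OrthonormalBasis.equiv_apply_basis, hb']; rfl
    exact this
  have hpow1 : ∀ i (h : i + 1 < N + 2),
      ((U : EuclideanSpace ℂ (Fin (N + 2)) →L[ℂ] EuclideanSpace ℂ (Fin (N + 2))) ^ i) (b 1) = b ⟨i + 1, h⟩ := by
    intro i
    induction i with
    | zero => intro h; simp
    | succ i ih =>
      intro h
      rw [pow_succ', mul_apply_eq_comp, ih (by omega), hU]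
      have : (⟨i + 1, by omega⟩ + 1 : Fin (N + 2)) = ⟨i + 1 + 1, h⟩ := by
        ext; simp [Fin.val_add, Nat.mod_eq_of_lt h]
      rw [this]
      refine (if_neg fun h0 => ?_).trans (if_neg fun h1 => ?_)
      · simpa using congrArg Fin.val h0
      · simpa using congrArg Fin.val h1
  have hlast : ((U : EuclideanSpace ℂ (Fin (N + 2)) →L[ℂ] EuclideanSpace ℂ (Fin (N + 2))) ^ (N + 1)) (b 1) =
      ε • ((s : ℂ) • b 0 - (r : ℂ) • b 1) := by
    rw [pow_succ', mul_apply_eq_comp, hpow1 N (by omega), hU]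
    have : (⟨N + 1, by omega⟩ + 1 : Fin (N + 2)) = 0 := Fin.last_add_one _
    rw [this]
    simp [u]
  have hstep : ∀ j, ((U : EuclideanSpace ℂ (Fin (N + 2)) →L[ℂ] EuclideanSpace ℂ (Fin (N + 2))) ^ (j + 1)) (b 0) =
      (r : ℂ) • ((U : EuclideanSpace ℂ (Fin (N + 2)) →L[ℂ] EuclideanSpace ℂ (Fin (N + 2))) ^ j) (b 0) +
      (s : ℂ) • ((U : EuclideanSpace ℂ (Fin (N + 2)) →L[ℂ] EuclideanSpace ℂ (Fin (N + 2))) ^ j) (b 1) := fun j => by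
    rw [pow_succ, mul_apply_eq_comp, hU]
    simp only [u, zero_add, h10, if_true, if_false, map_add, map_smul]
  have hmom : ∀ j ≤ N + 1,
      ⟪b 0, ((U : EuclideanSpace ℂ (Fin (N + 2)) →L[ℂ] EuclideanSpace ℂ (Fin (N + 2))) ^ j) (b 0)⟫_ℂ = (r : ℂ) ^ j := by
    intro j
    induction j with
    | zero => intro _; simp
    | succ j ih =>
      intro h
      rw [hstep, inner_add_right, inner_smul_right, inner_smul_right, ih (by omega),
        hpow1 j (by omega), hbi, if_neg (by simp [Fin.ext_iff])]
      ring
  refine ⟨U, U.2, b 0, b.orthonormal.1 0, hmom, ?_⟩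
  rw [hstep, inner_add_right, inner_smul_right, inner_smul_right, hmom _ le_rfl, hlast,
    inner_smul_right, inner_sub_right, inner_smul_right, inner_smul_right, hbi, hbi, if_pos rfl,
    if_neg h10.symm]
  linear_combination ε * hsc

/-- A polynomial of degree at most `d`, `d ≥ 2`, bounded by `M` on the unit circle satisfies
`|q(r)| + (1 - r ^ 2) |q_d| ≤ M`. -/
theorem norm_eval_add_norm_coeff_le {d : ℕ} (hd : 2 ≤ d) {q : ℂ[X]} (hq : q.natDegree ≤ d)
    {M : ℝ} (hM : ∀ z : ℂ, ‖z‖ = 1 → ‖q.eval z‖ ≤ M) {r : ℝ} (hr : r ^ 2 ≤ 1) :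
    ‖q.eval (r : ℂ)‖ + (1 - r ^ 2) * ‖q.coeff d‖ ≤ M := by
  obtain ⟨N, rfl⟩ := Nat.exists_eq_add_of_le' hd
  -- The free phase in the last moment aligns the two terms of ⟨e, q(U) e⟩, so that their norms add.
  obtain ⟨ε, hε, h⟩ := exists_norm_eq_one_norm_add_mul (q.eval (r : ℂ))
    (((1 - r ^ 2 : ℝ) : ℂ) * q.coeff (N + 2))
  rw [norm_mul _ (q.coeff _), Complex.norm_real, Real.norm_of_nonneg (by linarith)] at h
  rw [← h]
  have hM0 : 0 ≤ M := (norm_nonneg _).trans (hM 1 (by simp))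
  obtain ⟨U, hU, e, he, h1, h2⟩ := exists_unitary_moments N hr hε
  have hn := norm_aeval_le_of_mem_unitary hU q hM0 hM
  have hinner : inner ℂ e ((aeval U q) e) =
      q.eval (r : ℂ) + ε * (((1 - r ^ 2 : ℝ) : ℂ) * q.coeff (N + 2)) := by
    rw [aeval_eq_sum_range' (Nat.lt_succ_of_le hq), eval_eq_sum_range' (Nat.lt_succ_of_le hq)]
    simp only [sum_apply, inner_sum, smul_apply,
      inner_smul_right]
    rw [Finset.sum_range_succ, Finset.sum_range_succ _ (N + 2), h2, Finset.sum_congr rfl fun j hj => by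
      rw [h1 j (by have := Finset.mem_range.1 hj; omega)]]
    push_cast
    ring
  rw [← hinner]
  calc _ ≤ ‖e‖ * ‖(aeval U q) e‖ := norm_inner_le_norm _ _
    _ ≤ ‖e‖ * (‖aeval U q‖ * ‖e‖) := by gcongr; exact ContinuousLinearMap.le_opNorm _ _
    _ ≤ M := by rw [he]; simpa using hn

/-! ### Reversed polynomials and growth off the unit circle -/

theorem natDegree_reflect_le_of_le {R : Type*} [Semiring R] {n : ℕ} {p : R[X]}
    (hp : p.natDegree ≤ n) : (reflect n p).natDegree ≤ n :=
  natDegree_reflect_le.trans (max_le le_rfl hp)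

theorem eval_reflect_inv_mul_pow {n : ℕ} {p : ℂ[X]} (hp : p.natDegree ≤ n) {z : ℂ} (hz : z ≠ 0) :
    (reflect n p).eval z⁻¹ * z ^ n = p.eval z := by
  let _ := invertibleOfNonzero hz
  simpa [eval₂_id, invOf_eq_inv] using eval₂_reflect_mul_pow (RingHom.id ℂ) z n p hp

theorem eval_reflect {n : ℕ} {p : ℂ[X]} (hp : p.natDegree ≤ n) {z : ℂ} (hz : z ≠ 0) :
    (reflect n p).eval z = z ^ n * p.eval z⁻¹ := by
  have := eval_reflect_inv_mul_pow hp (inv_ne_zero hz)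
  rw [inv_inv] at this
  rw [← this, mul_comm, mul_assoc, ← mul_pow, inv_mul_cancel₀ hz, one_pow, mul_one]

/-- Growth of a polynomial of degree at most `d ≥ 2` off the unit circle, with the correction
coming from its constant coefficient. -/
theorem norm_eval_mul_le {d : ℕ} (hd : 2 ≤ d) {p : ℂ[X]} (hp : p.natDegree ≤ d)
    {M : ℝ} (hM : ∀ z : ℂ, ‖z‖ = 1 → ‖p.eval z‖ ≤ M) {R : ℝ} (hR : 1 ≤ R) {z : ℂ} (hz : ‖z‖ = 1) :
    ‖p.eval (R * z)‖ ≤ R ^ d * (M - (1 - 1 / R ^ 2) * ‖p.coeff 0‖) := by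
  have hR0 : 0 < R := by linarith
  have hRc : (R : ℂ) ≠ 0 := by exact_mod_cast hR0.ne'
  have hp1 : (p.comp (C z * X)).natDegree ≤ d := by
    refine natDegree_comp_le.trans ?_
    calc _ ≤ p.natDegree * 1 := Nat.mul_le_mul_left _ (by compute_degree)
      _ ≤ d := by simpa using hp
  -- Reversal turns the point R into 1/R and the constant coefficient into the coefficient of index
  -- d.
  have h := norm_eval_add_norm_coeff_le hd (natDegree_reflect_le_of_le hp1) (M := M)
    (r := R⁻¹) (fun w hw => by
      have hw0 : w ≠ 0 := by rintro rfl; simp at hw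
      rw [eval_reflect hp1 hw0, norm_mul, norm_pow, hw, one_pow, one_mul]
      simpa using hM (z * w⁻¹) (by simp [hz, hw])) (by
      have : R⁻¹ ≤ 1 := inv_le_one_of_one_le₀ hR
      have : 0 < R⁻¹ := by positivity
      nlinarith)
  have h2 : ‖p.eval (R * z)‖ = ‖(reflect d (p.comp (C z * X))).eval ((R⁻¹ : ℝ) : ℂ)‖ * R ^ d := by
    have := eval_reflect_inv_mul_pow hp1 hRc
    rw [Complex.ofReal_inv]
    rw [mul_comm (R : ℂ) z]
    simp only [eval_comp, eval_mul, eval_C, eval_X] at this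
    rw [← this, norm_mul, norm_pow, Complex.norm_real, Real.norm_of_nonneg hR0.le]
  rw [h2, mul_comm]
  gcongr
  rw [coeff_reflect, revAt_le le_rfl, Nat.sub_self, comp_C_mul_X_coeff, pow_zero, mul_one] at h
  rw [one_div, ← inv_pow]
  linarith

/-- The growth bound for polynomials of degree at most `n - 1`, `n ≥ 2`, in terms of `psi`. -/
theorem norm_eval_mul_le_psi {n : ℕ} (hn : 2 ≤ n) {p : ℂ[X]} (hp : p.natDegree ≤ n - 1)
    {M : ℝ} (hM : ∀ z : ℂ, ‖z‖ = 1 → ‖p.eval z‖ ≤ M) {R : ℝ} (hR : 1 ≤ R) {z : ℂ} (hz : ‖z‖ = 1) :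
    ‖p.eval (R * z)‖ ≤ R ^ (n - 1) * (M - psi n R * ‖p.coeff 0‖) := by
  rcases hn.lt_or_eq with h | rfl
  · rw [psi, if_pos h]
    exact norm_eval_mul_le (by omega) hp hM hR hz
  -- Here p is affine, so the unitary argument, which needs d ≥ 2, is replaced by |p_0| + |p_1| ≤ M.
  · have hR0 : 0 < R := by linarith
    rw [psi, if_neg (lt_irrefl 2)]
    have hpe : ∀ w, p.eval w = p.coeff 0 + p.coeff 1 * w := fun w => by
      rw [eval_eq_sum_range' (Nat.lt_succ_of_le hp)]
      simp [Finset.sum_range_succ]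
    have hMs : ‖p.coeff 0‖ + ‖p.coeff 1‖ ≤ M := by
      obtain ⟨ε, hε, h⟩ := exists_norm_eq_one_norm_add_mul (p.coeff 0) (p.coeff 1)
      rw [← h, mul_comm, ← hpe]
      exact hM _ hε
    calc ‖p.eval (R * z)‖ ≤ ‖p.coeff 0‖ + ‖p.coeff 1‖ * R := by
          rw [hpe]
          refine (norm_add_le _ _).trans ?_
          simp [hz, abs_of_pos hR0]
      _ ≤ R * (‖p.coeff 0‖ + ‖p.coeff 1‖) - (R - 1) * ‖p.coeff 0‖ := by linarith
      _ ≤ R * M - (R - 1) * ‖p.coeff 0‖ := by gcongr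
      _ = _ := by norm_num; field_simp

/-! ### Zeros and the logarithmic derivative -/

/-- Take x = Re(z ā) and expand |z - a|². Both bounds on the contribution of a zero a to Re(z p'/p)
then become polynomial inequalities in x and |a|. -/
theorem re_div_sub_eq {z a : ℂ} (hz : ‖z‖ = 1) (h : z ≠ a) :
    ∃ x : ℝ, |x| ≤ ‖a‖ ∧ 0 < 1 + ‖a‖ ^ 2 - 2 * x ∧
      (z / (z - a)).re = (1 - x) / (1 + ‖a‖ ^ 2 - 2 * x) := by
  have hz2 : z.re * z.re + z.im * z.im = 1 := by
    rw [← Complex.normSq_apply, Complex.normSq_eq_norm_sq, hz]; norm_num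
  have ha2 : a.re * a.re + a.im * a.im = ‖a‖ ^ 2 := by
    rw [← Complex.normSq_apply, Complex.normSq_eq_norm_sq]
  have hN : Complex.normSq (z - a) = 1 + ‖a‖ ^ 2 - 2 * (z * (starRingEnd ℂ) a).re := by
    rw [Complex.normSq_apply]
    simp
    linear_combination hz2 + ha2
  refine ⟨(z * (starRingEnd ℂ) a).re, ?_, ?_, ?_⟩
  · refine (Complex.abs_re_le_norm _).trans ?_
    simp [hz]
  · rw [← hN]
    exact Complex.normSq_pos.2 (sub_ne_zero.2 h)
  · rw [Complex.div_re, hN, ← add_div]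
    congr 1
    simp
    linear_combination hz2

theorem re_div_sub_le_half {z a : ℂ} (hz : ‖z‖ = 1) (ha : 1 ≤ ‖a‖) (h : z ≠ a) :
    (z / (z - a)).re ≤ 1 / 2 := by
  obtain ⟨x, -, hpos, hx⟩ := re_div_sub_eq hz h
  rw [hx, div_le_iff₀ hpos]
  nlinarith

theorem inv_one_add_norm_le_re_div_sub {z a : ℂ} (hz : ‖z‖ = 1) (ha : ‖a‖ ≤ 1) (h : z ≠ a) :
    1 / 2 + 1 / 2 * ((1 - ‖a‖) / (1 + ‖a‖)) ≤ (z / (z - a)).re := by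
  obtain ⟨x, hxa, hpos, hx⟩ := re_div_sub_eq hz h
  have h0 := norm_nonneg a
  have e : 1 / 2 + 1 / 2 * ((1 - ‖a‖) / (1 + ‖a‖)) = 1 / (1 + ‖a‖) := by field_simp; ring
  rw [hx, e, div_le_div_iff₀ (by linarith) hpos]
  nlinarith [mul_nonneg (sub_nonneg.2 ha) (by linarith [(abs_le.1 hxa).1] : 0 ≤ ‖a‖ + x)]

theorem mul_eval_derivative_div_eval (p : ℂ[X]) {z : ℂ} (hz : p.eval z ≠ 0) :
    (z * p.derivative.eval z / p.eval z).re = (p.roots.map fun a => (z / (z - a)).re).sum := by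
  rw [mul_div_assoc, (IsAlgClosed.splits p).eval_derivative_div_eval_of_ne_zero hz,
    ← Multiset.sum_map_mul_left]
  have := map_multiset_sum Complex.reAddGroupHom (p.roots.map fun a => z * (1 / (z - a)))
  simp only [Multiset.map_map, Function.comp_def, Complex.coe_reAddGroupHom, mul_one_div] at this ⊢
  exact this

/-- For a polynomial of degree at most `n` without zeros in the open unit disc,
`|g'| ≤ |n g - z g'|` on the unit circle. -/
theorem norm_derivative_le_of_no_zeros {n : ℕ} {g : ℂ[X]} (hg : g.natDegree ≤ n)
    (h0 : ∀ z : ℂ, ‖z‖ < 1 → g.eval z ≠ 0) {z : ℂ} (hz : ‖z‖ = 1) :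
    ‖g.derivative.eval z‖ ≤ ‖n * g.eval z - z * g.derivative.eval z‖ := by
  by_cases hgz : g.eval z = 0
  · simp [hgz, hz]
  have hre : (z * g.derivative.eval z / g.eval z).re ≤ n / 2 := by
    rw [mul_eval_derivative_div_eval g hgz]
    refine (Multiset.sum_le_card_nsmul _ (1 / 2) fun x hx => ?_).trans ?_
    · obtain ⟨a, ha, rfl⟩ := Multiset.mem_map.1 hx
      have har : g.eval a = 0 := (mem_roots'.1 ha).2
      refine re_div_sub_le_half hz (not_lt.1 fun hlt => h0 a hlt har) ?_
      rintro rfl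
      exact hgz har
    · have : (g.roots.card : ℝ) ≤ n := by exact_mod_cast (card_roots' g).trans hg
      rw [Multiset.card_map, nsmul_eq_mul]
      linarith
  -- The condition Re w ≤ n/2 says that w is at least as close to 0 as to n.
  set w := z * g.derivative.eval z / g.eval z with hw
  have hw1 : z * g.derivative.eval z = w * g.eval z := by rw [hw]; field_simp
  have h1 : ‖g.derivative.eval z‖ = ‖w‖ * ‖g.eval z‖ := by
    rw [← norm_mul, ← hw1, norm_mul, hz, one_mul]
  rw [h1, hw1, ← sub_mul, norm_mul]
  refine mul_le_mul_of_nonneg_right ?_ (norm_nonneg _)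
  refine le_of_sq_le_sq ?_ (norm_nonneg _)
  rw [← Complex.normSq_eq_norm_sq, ← Complex.normSq_eq_norm_sq, Complex.normSq_apply,
    Complex.normSq_apply]
  simp
  nlinarith [(Nat.cast_nonneg n : (0 : ℝ) ≤ n)]

/-! ### Bernstein and Erdős–Lax inequalities by perturbation -/

/-- Translation of `v` by a multiple of its own direction. -/
theorem exists_norm_eq_norm_sub_mul (v : ℂ) (n : ℕ) {t : ℝ} (ht : 0 ≤ t) :
    ∃ β : ℂ, ‖β‖ = t ∧ ‖v - n * β‖ = |‖v‖ - n * t| := by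
  obtain ⟨e, he, hv⟩ := exists_unit_eq_norm_mul v
  refine ⟨t * e, by simp [he, abs_of_nonneg ht], ?_⟩
  have : v - n * (t * e) = ((‖v‖ - n * t : ℝ) : ℂ) * e := by
    conv_lhs => rw [hv]
    push_cast; ring
  rw [this, norm_mul, he, mul_one, Complex.norm_real, Real.norm_eq_abs]

/-- The maximum principle on the unit disc. -/
theorem norm_eval_le_of_norm_le_one {g : ℂ[X]} {M : ℝ}
    (hM : ∀ z : ℂ, ‖z‖ = 1 → ‖g.eval z‖ ≤ M) {z : ℂ} (hz : ‖z‖ ≤ 1) : ‖g.eval z‖ ≤ M := by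
  refine Complex.norm_le_of_forall_mem_frontier_norm_le (U := Metric.ball 0 1)
    Metric.isBounded_ball g.differentiable.diffContOnCl (fun w hw => ?_) ?_
  · rw [frontier_ball _ one_ne_zero] at hw
    exact hM w (by simpa using hw)
  · rw [closure_ball _ one_ne_zero]
    simpa using hz

/-- The minimum principle on the unit disc. -/
theorem le_norm_eval_of_no_zeros {g : ℂ[X]} {m : ℝ}
    (h0 : ∀ z : ℂ, ‖z‖ < 1 → g.eval z ≠ 0) (hm : ∀ z : ℂ, ‖z‖ = 1 → m ≤ ‖g.eval z‖)
    {z : ℂ} (hz : ‖z‖ ≤ 1) : m ≤ ‖g.eval z‖ := by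
  rcases le_or_gt m 0 with hm0 | hm0
  · exact hm0.trans (norm_nonneg _)
  have hne : ∀ w : ℂ, ‖w‖ ≤ 1 → g.eval w ≠ 0 := fun w hw h => by
    rcases hw.lt_or_eq with h1 | h1
    · exact h0 w h1 h
    · have := hm w h1
      rw [h, norm_zero] at this
      linarith
  have key : ‖(g.eval z)⁻¹‖ ≤ m⁻¹ := by
    refine Complex.norm_le_of_forall_mem_frontier_norm_le (U := Metric.ball 0 1)
      (f := fun w => (g.eval w)⁻¹) Metric.isBounded_ball ?_ (fun w hw => ?_) ?_
    · refine g.differentiable.diffContOnCl.inv fun w hw => hne w ?_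
      rw [closure_ball _ one_ne_zero] at hw
      simpa using hw
    · rw [frontier_ball _ one_ne_zero] at hw
      rw [norm_inv]
      exact inv_anti₀ hm0 (hm w (by simpa using hw))
    · rw [closure_ball _ one_ne_zero]
      simpa using hz
  rw [norm_inv] at key
  exact (inv_le_inv₀ (norm_pos_iff.2 (hne z hz)) hm0).1 key

/-- The sharp form of Bernstein's inequality involving the reciprocal polynomial. -/
theorem norm_derivative_add_le {n : ℕ} (hn : 0 < n) {g : ℂ[X]} (hg : g.natDegree ≤ n) {M : ℝ}
    (hM : ∀ z : ℂ, ‖z‖ = 1 → ‖g.eval z‖ ≤ M) {z : ℂ} (hz : ‖z‖ = 1) :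
    ‖g.derivative.eval z‖ + ‖n * g.eval z - z * g.derivative.eval z‖ ≤ n * M := by
  have hn' : (0 : ℝ) < n := by exact_mod_cast hn
  have hM0 : 0 ≤ M := (norm_nonneg _).trans (hM z hz)
  set v := n * g.eval z - z * g.derivative.eval z with hv
  -- By the maximum principle g - β has no zeros in the disc.
  have key : ∀ β : ℂ, M < ‖β‖ → ‖g.derivative.eval z‖ ≤ ‖v - n * β‖ := fun β hβ => by
    have := norm_derivative_le_of_no_zeros (g := g - C β) (n := n)
      ((natDegree_sub_C).le.trans hg) (fun w hw h => by
        rw [eval_sub, eval_C, sub_eq_zero] at h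
        have := norm_eval_le_of_norm_le_one hM hw.le
        rw [h] at this
        linarith) hz
    simp only [derivative_sub, derivative_C, sub_zero, eval_sub, eval_C] at this
    convert this using 2
    rw [hv]; ring
  -- Otherwise β = v/n is admissible and forces g'(z) = 0, so v = n g(z), contradicting |g(z)| ≤ M.
  have hvM : ‖v‖ ≤ n * M := by
    by_contra! hlt
    have h1 := key (v / n) (by
      rw [norm_div, Complex.norm_natCast, lt_div_iff₀ hn']
      linarith)
    have hnc : (n : ℂ) ≠ 0 := by exact_mod_cast hn.ne'
    rw [mul_div_cancel₀ _ hnc, sub_self, norm_zero, norm_le_zero_iff] at h1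
    rw [hv, h1, mul_zero, sub_zero, norm_mul, Complex.norm_natCast] at hlt
    exact absurd (hM z hz) (not_le.2 (lt_of_mul_lt_mul_left hlt hn'.le))
  -- With β in the direction of v and |β| = t, the bound reads |g'| ≤ nt - |v|; then t decreases to
  -- M.
  have h2 : ∀ t, M < t → (‖g.derivative.eval z‖ + ‖v‖) / n ≤ t := fun t ht => by
    obtain ⟨β, hβ, hβ2⟩ := exists_norm_eq_norm_sub_mul v n (hM0.trans ht.le)
    have := key β (hβ.symm ▸ ht)
    rw [hβ2, abs_of_nonpos (by nlinarith)] at this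
    rw [div_le_iff₀ hn']
    linarith
  have := le_of_forall_gt_imp_ge_of_dense h2
  rw [div_le_iff₀ hn'] at this
  linarith

/-- The Erdős–Lax inequality with a minimum modulus term. -/
theorem norm_derivative_le_half {n : ℕ} (hn : 0 < n) {g : ℂ[X]} (hg : g.natDegree ≤ n) {M μ : ℝ}
    (hM : ∀ z : ℂ, ‖z‖ = 1 → ‖g.eval z‖ ≤ M) (hμ : 0 ≤ μ)
    (hlt : ∀ z : ℂ, ‖z‖ < 1 → μ < ‖g.eval z‖) (hle : ∀ z : ℂ, ‖z‖ = 1 → μ ≤ ‖g.eval z‖)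
    {z : ℂ} (hz : ‖z‖ = 1) : ‖g.derivative.eval z‖ ≤ n / 2 * (M - μ) := by
  have hn' : (0 : ℝ) < n := by exact_mod_cast hn
  have h1 := norm_derivative_add_le hn hg hM hz
  set v := n * g.eval z - z * g.derivative.eval z with hv
  have key : ∀ β : ℂ, ‖β‖ ≤ μ → ‖g.derivative.eval z‖ ≤ ‖v - n * β‖ := fun β hβ => by
    have := norm_derivative_le_of_no_zeros (g := g - C β) (n := n)
      ((natDegree_sub_C).le.trans hg) (fun w hw h => by
        rw [eval_sub, eval_C, sub_eq_zero] at h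
        have := hlt w hw
        rw [h] at this
        linarith) hz
    simp only [derivative_sub, derivative_C, sub_zero, eval_sub, eval_C] at this
    convert this using 2
    rw [hv]; ring
  have hvμ : n * μ ≤ ‖v‖ := by
    by_contra! hc
    have hvn : ‖v / n‖ < μ := by
      rw [norm_div, Complex.norm_natCast, div_lt_iff₀ hn']
      linarith
    have h1 := key (v / n) hvn.le
    have hnc : (n : ℂ) ≠ 0 := by exact_mod_cast hn.ne'
    rw [mul_div_cancel₀ _ hnc, sub_self, norm_zero, norm_le_zero_iff] at h1
    rw [hv, h1, mul_zero, sub_zero, norm_mul, Complex.norm_natCast] at hc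
    exact absurd (hle z hz) (not_le.2 (lt_of_mul_lt_mul_left hc hn'.le))
  -- This β gives |g'| ≤ |v| - nμ; adding |g'| + |v| ≤ nM finishes.
  obtain ⟨β, hβ, hβ2⟩ := exists_norm_eq_norm_sub_mul v n hμ
  have := key β hβ.le
  rw [hβ2, abs_of_nonneg (by linarith)] at this
  linarith

/-! ### Turán-type lower bounds -/

/-- The right side is 2(1 - xy)/((1 + x)(1 + y)), and (1 - x)(1 - y) ≥ 0 gives (1 + x)(1 + y) ≤ 2(1
+ xy). This merges the contributions of the zeros into one term in their product, which Vieta's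
formula expresses through the end coefficients. -/
theorem ratio_mul_le_add {x y : ℝ} (hx0 : 0 ≤ x) (hx : x ≤ 1) (hy0 : 0 ≤ y) (hy : y ≤ 1) :
    (1 - x * y) / (1 + x * y) ≤ (1 - x) / (1 + x) + (1 - y) / (1 + y) := by
  have hxy : 0 ≤ x * y := mul_nonneg hx0 hy0
  have hxy1 : x * y ≤ 1 := mul_le_one₀ hx hy0 hy
  have e : (1 - x) / (1 + x) + (1 - y) / (1 + y) = 2 * (1 - x * y) / ((1 + x) * (1 + y)) := by
    field_simp; ring
  rw [e, div_le_div_iff₀ (by linarith) (by positivity)]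
  have h : (1 + x) * (1 + y) ≤ 2 * (1 + x * y) := by
    nlinarith [mul_nonneg (sub_nonneg.2 hx) (sub_nonneg.2 hy)]
  nlinarith [mul_le_mul_of_nonneg_left h (sub_nonneg.2 hxy1)]

theorem half_add_ratio_prod_le_sum (s : Multiset ℂ) (hs : ∀ a ∈ s, ‖a‖ ≤ 1) :
    ‖s.prod‖ ≤ 1 ∧ (s.card : ℝ) / 2 + 1 / 2 * ((1 - ‖s.prod‖) / (1 + ‖s.prod‖)) ≤
      (s.map fun a => 1 / 2 + 1 / 2 * ((1 - ‖a‖) / (1 + ‖a‖))).sum := by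
  induction s using Multiset.induction_on with
  | empty => simp
  | cons a s ih =>
    obtain ⟨h1, h2⟩ := ih fun b hb => hs b (Multiset.mem_cons_of_mem hb)
    have ha := hs a (Multiset.mem_cons_self a s)
    rw [Multiset.prod_cons, Multiset.map_cons, Multiset.sum_cons, Multiset.card_cons, norm_mul]
    refine ⟨mul_le_one₀ ha (norm_nonneg _) h1, ?_⟩
    have := ratio_mul_le_add (norm_nonneg a) ha (norm_nonneg s.prod) h1
    push_cast
    linarith

/-- Dubinin's refinement of Turán's inequality for polynomials with all zeros in the closed unit
disc. -/
theorem half_mul_norm_eval_le_norm_derivative {F : ℂ[X]} (hF : F ≠ 0)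
    (h0 : ∀ a : ℂ, F.eval a = 0 → ‖a‖ ≤ 1) {z : ℂ} (hz : ‖z‖ = 1) :
    1 / 2 * (F.natDegree + (‖F.leadingCoeff‖ - ‖F.coeff 0‖) / (‖F.leadingCoeff‖ + ‖F.coeff 0‖)) *
      ‖F.eval z‖ ≤ ‖F.derivative.eval z‖ := by
  by_cases hFz : F.eval z = 0
  · simp [hFz]
  have hroot : ∀ a ∈ F.roots, F.eval a = 0 := fun a ha => (mem_roots'.1 ha).2
  have hre : 1 / 2 * (F.natDegree +
      (‖F.leadingCoeff‖ - ‖F.coeff 0‖) / (‖F.leadingCoeff‖ + ‖F.coeff 0‖)) ≤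
      (z * F.derivative.eval z / F.eval z).re := by
    rw [mul_eval_derivative_div_eval F hFz]
    have h1 := (half_add_ratio_prod_le_sum F.roots fun a ha => h0 a (hroot a ha)).2
    have h2 : (F.roots.map fun a => 1 / 2 + 1 / 2 * ((1 - ‖a‖) / (1 + ‖a‖))).sum ≤
        (F.roots.map fun a => (z / (z - a)).re).sum := by
      refine Multiset.sum_map_le_sum_map _ _ fun a ha =>
        inv_one_add_norm_le_re_div_sub hz (h0 a (hroot a ha)) ?_
      rintro rfl
      exact hFz (hroot _ ha)
    have hc : ‖F.coeff 0‖ = ‖F.leadingCoeff‖ * ‖F.roots.prod‖ := by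
      rw [(IsAlgClosed.splits F).coeff_zero_eq_leadingCoeff_mul_prod_roots]
      simp
    have hl : 0 < ‖F.leadingCoeff‖ := norm_pos_iff.2 (leadingCoeff_ne_zero.2 hF)
    have hr : (‖F.leadingCoeff‖ - ‖F.coeff 0‖) / (‖F.leadingCoeff‖ + ‖F.coeff 0‖) =
        (1 - ‖F.roots.prod‖) / (1 + ‖F.roots.prod‖) := by
      rw [hc]
      have := norm_nonneg F.roots.prod
      field_simp
    rw [splits_iff_card_roots.1 (IsAlgClosed.splits F)] at h1
    rw [hr]
    linarith
  have h3 := hre.trans ((le_abs_self _).trans (Complex.abs_re_le_norm _))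
  rwa [norm_div, norm_mul, hz, one_mul, le_div_iff₀ (norm_pos_iff.2 hFz)] at h3

/-- The ratio appearing in Dubinin's inequality is monotone in the leading coefficient. -/
theorem ratio_mono {x y c : ℝ} (hx : 0 < x) (hxy : x ≤ y) (hc : 0 ≤ c) :
    (x - c) / (x + c) ≤ (y - c) / (y + c) := by
  rw [div_le_div_iff₀ (by linarith) (by linarith)]
  nlinarith

theorem neg_one_le_ratio {x c : ℝ} (hx : 0 < x) (hc : 0 ≤ c) : -1 ≤ (x - c) / (x + c) := by
  rw [le_div_iff₀ (by linarith)]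
  linarith

/-- The refined Turán inequality with a minimum modulus term. -/
theorem half_mul_sub_add_le_norm_derivative {n : ℕ} (hn : 2 ≤ n) {f : ℂ[X]} (hf : f.natDegree ≤ n)
    {μ : ℝ} (hμ : 0 ≤ μ) (hgt : ∀ z : ℂ, 1 < ‖z‖ → μ * ‖z‖ ^ n < ‖f.eval z‖)
    (hge : ∀ z : ℂ, ‖z‖ = 1 → μ ≤ ‖f.eval z‖) (hlead : μ < ‖f.coeff n‖) {z : ℂ} (hz : ‖z‖ = 1) :
    1 / 2 * (n + (‖f.coeff n‖ - μ - ‖f.coeff 0‖) / (‖f.coeff n‖ - μ + ‖f.coeff 0‖)) *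
      (‖f.eval z‖ - μ) + n * μ ≤ ‖f.derivative.eval z‖ := by
  have hn' : (2 : ℝ) ≤ n := by exact_mod_cast hn
  have hn0 : (0 : ℝ) < n := by linarith
  have hnc : (n : ℂ) ≠ 0 := by exact_mod_cast (by omega : n ≠ 0)
  have hz0 : z ≠ 0 := by rintro rfl; simp at hz
  have hs := neg_one_le_ratio (sub_pos.2 hlead) (norm_nonneg (f.coeff 0))
  set s := (‖f.coeff n‖ - μ - ‖f.coeff 0‖) / (‖f.coeff n‖ - μ + ‖f.coeff 0‖) with hsdef
  have hzn : ‖z ^ n‖ = 1 := by rw [norm_pow, hz, one_pow]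
  -- Dubinin's bound is applied to f - β z^n, whose zeros stay in the closed disc because |f| >
  -- μ|z|^n outside it. The shift moves z f'(z) by nγ, where γ is the value of β z^n at the given
  -- point.
  have key : ∀ β : ℂ, ‖β‖ ≤ μ → 1 / 2 * (n + s) * (‖f.eval z‖ - ‖β‖) ≤
      ‖z * f.derivative.eval z - n * β‖ := fun γ hγ => by
    obtain ⟨β, hβγ, hβ⟩ : ∃ β : ℂ, γ = β * z ^ n ∧ ‖β‖ ≤ μ :=
      ⟨γ / z ^ n, by field_simp, by rwa [norm_div, hzn, div_one]⟩
    have hFn : (f - C β * X ^ n).coeff n = f.coeff n - β := by simp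
    have hnorm : ‖f.coeff n‖ - μ ≤ ‖f.coeff n - β‖ := by
      have := norm_sub_norm_le (f.coeff n) β
      linarith
    have hpos : 0 < ‖f.coeff n - β‖ := by linarith
    have hdeg : (f - C β * X ^ n).natDegree = n := by
      refine natDegree_eq_of_le_of_coeff_ne_zero ?_ ?_
      · exact (natDegree_sub_le _ _).trans (max_le hf (natDegree_C_mul_X_pow_le _ _))
      · rw [hFn]; exact norm_pos_iff.1 hpos
    have hF0 : (f - C β * X ^ n).coeff 0 = f.coeff 0 := by
      rw [coeff_sub, coeff_C_mul, coeff_X_pow, if_neg (by omega), mul_zero, sub_zero]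
    have h := half_mul_norm_eval_le_norm_derivative (F := f - C β * X ^ n)
      (fun h => by rw [h, coeff_zero] at hFn; rw [← hFn] at hpos; simp at hpos)
      (fun a ha => by
        by_contra! hlt
        rw [eval_sub, sub_eq_zero] at ha
        have h1 := hgt a hlt
        rw [ha] at h1
        simp only [eval_mul, eval_C, eval_pow, eval_X, norm_mul, norm_pow] at h1
        have : 0 ≤ ‖a‖ ^ n := by positivity
        nlinarith) hz
    rw [leadingCoeff, hdeg, hFn, hF0] at h
    have hmono := ratio_mono (sub_pos.2 hlead) hnorm (norm_nonneg (f.coeff 0))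
    rw [← hsdef] at hmono
    have hev : ‖f.eval z‖ - ‖γ‖ ≤ ‖(f - C β * X ^ n).eval z‖ := by
      have := norm_sub_norm_le (f.eval z) γ
      rw [hβγ] at this ⊢
      simpa using this
    have hder : ‖z * f.derivative.eval z - n * γ‖ = ‖(f - C β * X ^ n).derivative.eval z‖ := by
      have : z * f.derivative.eval z - n * γ = z * (f - C β * X ^ n).derivative.eval z := by
        obtain ⟨N, rfl⟩ := Nat.exists_eq_add_of_le' (by omega : 1 ≤ n)
        rw [hβγ]
        simp only [derivative_sub, derivative_C_mul_X_pow, eval_sub, eval_mul, eval_C, eval_pow,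
          eval_X, Nat.add_sub_cancel]
        ring
      rw [this, norm_mul, hz, one_mul]
    rw [hder]
    refine le_trans ?_ h
    have hns : (0 : ℝ) ≤ 1 / 2 * (n + s) := by linarith
    exact (mul_le_mul_of_nonneg_left hev hns).trans
      (mul_le_mul_of_nonneg_right (by linarith) (norm_nonneg _))
  have hfd : ‖f.derivative.eval z‖ = ‖z * f.derivative.eval z‖ := by rw [norm_mul, hz, one_mul]
  rw [hfd]
  set v := z * f.derivative.eval z
  -- Otherwise γ = v/n makes the right side of `key` zero, while its left side is positive since n +
  -- s > 0 and |f(z)| ≥ μ > |γ|.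
  have hvμ : n * μ ≤ ‖v‖ := by
    by_contra! hc
    have hvn : ‖v / n‖ < μ := by
      rw [norm_div, Complex.norm_natCast, div_lt_iff₀ hn0]
      linarith
    have h1 := key (v / n) hvn.le
    rw [mul_div_cancel₀ _ hnc, sub_self, norm_zero] at h1
    have h2 := hge z hz
    have : 0 < 1 / 2 * (n + s) * (‖f.eval z‖ - ‖v / n‖) :=
      mul_pos (by linarith) (by linarith)
    linarith
  obtain ⟨β, hβ, hβ2⟩ := exists_norm_eq_norm_sub_mul v n hμ
  have := key β hβ.le
  rw [hβ2, hβ, abs_of_nonneg (by linarith)] at this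
  linarith

/-! ### The Ankeny–Rivlin bound -/

theorem hasDerivAt_phi {n : ℕ} (hn : 2 ≤ n) {t : ℝ} (ht : 0 < t) :
    HasDerivAt (phi n) (t ^ (n - 1) * psi n t) t := by
  rcases hn.lt_or_eq with h | rfl
  · have h1 : (n : ℝ) ≠ 0 := by exact_mod_cast (by omega : n ≠ 0)
    obtain ⟨N, rfl⟩ := Nat.exists_eq_add_of_le' (by omega : 3 ≤ n)
    have h2 : ((N + 3 : ℕ) : ℝ) - 2 = (N + 1 : ℝ) := by push_cast; ring
    have h3 : (N + 1 : ℝ) ≠ 0 := by positivity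
    have e : phi (N + 3) = fun k : ℝ =>
        (k ^ (N + 3) - 1) / ((N + 3 : ℕ) : ℝ) - (k ^ (N + 1) - 1) / (N + 1 : ℝ) := by
      funext k
      rw [phi, if_pos h, h2]
      rfl
    rw [e, psi, if_pos h]
    refine ((((hasDerivAt_pow (N + 3) t).sub_const 1).div_const _).sub
      (((hasDerivAt_pow (N + 1) t).sub_const 1).div_const _)).congr_deriv ?_
    simp only [Nat.add_sub_cancel, Nat.cast_add, Nat.cast_one, (by omega : N + 3 - 1 = N + 2)]
    push_cast at h1 ⊢
    field_simp
    ring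
  · have e : phi 2 = fun k : ℝ => (k - 1) ^ 2 / 2 := by
      funext k
      rw [phi, if_neg (lt_irrefl 2)]
    rw [e, psi, if_neg (lt_irrefl 2)]
    refine ((((hasDerivAt_id t).sub_const 1).pow 2).div_const 2).congr_deriv ?_
    simp
    field_simp

theorem phi_one (n : ℕ) : phi n 1 = 0 := by
  simp [phi]

theorem natDegree_derivative_le_pred {n : ℕ} {p : ℂ[X]} (hp : p.natDegree ≤ n) :
    p.derivative.natDegree ≤ n - 1 :=
  (natDegree_derivative_le p).trans (Nat.sub_le_sub_right hp 1)

/-- A refinement of the Ankeny–Rivlin inequality. -/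
theorem norm_eval_mul_le_of_no_zeros {n : ℕ} (hn : 2 ≤ n) {g : ℂ[X]} (hg : g.natDegree ≤ n)
    {M μ : ℝ} (hM : ∀ z : ℂ, ‖z‖ = 1 → ‖g.eval z‖ ≤ M) (hμ : 0 ≤ μ)
    (hlt : ∀ z : ℂ, ‖z‖ < 1 → μ < ‖g.eval z‖) (hle : ∀ z : ℂ, ‖z‖ = 1 → μ ≤ ‖g.eval z‖)
    {R : ℝ} (hR : 1 ≤ R) {z : ℂ} (hz : ‖z‖ = 1) :
    ‖g.eval (R * z)‖ ≤ ‖g.eval z‖ + (R ^ n - 1) / 2 * (M - μ) - ‖g.coeff 1‖ * phi n R := by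
  have hEL : ∀ w : ℂ, ‖w‖ = 1 → ‖g.derivative.eval w‖ ≤ n / 2 * (M - μ) :=
    fun w hw => norm_derivative_le_half (by omega) hg hM hμ hlt hle hw
  have hder : ∀ t : ℝ, HasDerivAt (fun t : ℝ => g.eval ((t : ℂ) * z))
      (g.derivative.eval ((t : ℂ) * z) * z) t := fun t => by
    have h1 : HasDerivAt (fun t : ℝ => (t : ℂ) * z) z t := by
      simpa using (Complex.ofRealCLM.hasDerivAt (x := t)).mul_const z
    exact (g.hasDerivAt ((t : ℂ) * z)).comp t h1
  have hB : ∀ t : ℝ, 0 < t → HasDerivAt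
      (fun t => ‖g.eval z‖ + (t ^ n - 1) / 2 * (M - μ) - ‖g.coeff 1‖ * phi n t)
      (t ^ (n - 1) * (n / 2 * (M - μ) - psi n t * ‖g.coeff 1‖)) t := fun t ht => by
    refine ((((((hasDerivAt_pow n t).sub_const 1).div_const 2).mul_const (M - μ)).const_add
      ‖g.eval z‖).sub ((hasDerivAt_phi hn ht).const_mul ‖g.coeff 1‖)).congr_deriv ?_
    ring
  -- Along the ray t ↦ tz, |g'| is bounded by the growth estimate with constant n(M - μ)/2 from
  -- Erdős–Lax; the claimed bound has exactly this derivative and agrees with |g(z)| at t = 1.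
  refine image_norm_le_of_norm_deriv_right_le_deriv_boundary' (a := 1) (b := R)
    (f := fun t : ℝ => g.eval ((t : ℂ) * z))
    (fun t _ => (hder t).continuousAt.continuousWithinAt)
    (fun t _ => (hder t).hasDerivWithinAt) (by simp [phi_one])
    (fun t ht => (hB t (by linarith [ht.1])).continuousAt.continuousWithinAt)
    (fun t ht => (hB t (by linarith [ht.1])).hasDerivWithinAt) (fun t ht => ?_)
    (Set.right_mem_Icc.2 hR)
  rw [norm_mul, hz, mul_one]
  simpa [coeff_derivative] using
    norm_eval_mul_le_psi hn (natDegree_derivative_le_pred hg) hEL ht.1 hz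

/-! ### Extrema on circles and the main inequality -/

theorem norm_eval_le_circleMax (P : ℂ[X]) {r : ℝ} {z : ℂ} (hz : ‖z‖ = r) :
    ‖P.eval z‖ ≤ circleMax P r :=
  (isGreatest_circleMax P (hz ▸ norm_nonneg z)).2 ⟨z, by simpa using hz, rfl⟩

theorem exists_norm_eval_eq_circleMax (P : ℂ[X]) {r : ℝ} (hr : 0 ≤ r) :
    ∃ z : ℂ, ‖z‖ = r ∧ ‖P.eval z‖ = circleMax P r := by
  obtain ⟨z, hz, h⟩ := (isGreatest_circleMax P hr).1
  exact ⟨z, by simpa using hz, h⟩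

theorem circleMin_le_norm_eval (P : ℂ[X]) {r : ℝ} {z : ℂ} (hz : ‖z‖ = r) :
    circleMin P r ≤ ‖P.eval z‖ :=
  (isLeast_circleMin P (hz ▸ norm_nonneg z)).2 ⟨z, by simpa using hz, rfl⟩

theorem circleMin_nonneg (P : ℂ[X]) {r : ℝ} (hr : 0 ≤ r) : 0 ≤ circleMin P r := by
  obtain ⟨z, -, h⟩ := (isLeast_circleMin P hr).1
  rw [← h]
  exact norm_nonneg _

/-- The bound for the derivative, together with the positivity of `k ^ n |a_n| - l m`. -/
theorem derivLowerBound_le_circleMax {n : ℕ} (hn : 2 ≤ n) {k : ℝ} (hk : 1 ≤ k) {P : ℂ[X]}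
    (hP : P.natDegree = n) (hroots : ∀ z : ℂ, P.IsRoot z → ‖z‖ ≤ k) {l : ℝ} (hl0 : 0 ≤ l)
    (hl1 : l < 1) :
    0 < k ^ n * ‖P.coeff n‖ - l * circleMin P k ∧
      derivLowerBound n k l P ≤ circleMax P.derivative 1 := by
  have hk0 : 0 < k := by linarith
  have hkc : (k : ℂ) ≠ 0 := by exact_mod_cast hk0.ne'
  have hPn : P.coeff n ≠ 0 := by
    rw [← hP]
    exact leadingCoeff_ne_zero.2 (by rintro rfl; simp at hP; omega)
  set f := P.comp (C (k : ℂ) * X) with hf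
  have hfc : ∀ j, f.coeff j = P.coeff j * (k : ℂ) ^ j := fun j => comp_C_mul_X_coeff
  have hfe : ∀ z, f.eval z = P.eval (k * z) := fun z => by simp [hf]
  have hfd : f.natDegree ≤ n := by
    refine natDegree_comp_le.trans ?_
    calc _ ≤ P.natDegree * 1 := Nat.mul_le_mul_left _ (by compute_degree)
      _ ≤ n := by simp [hP]
  set g := reflect n f with hg
  have hgd : g.natDegree ≤ n := natDegree_reflect_le_of_le hfd
  have hge : ∀ {z : ℂ}, z ≠ 0 → g.eval z = z ^ n * f.eval z⁻¹ := fun hz => eval_reflect hfd hz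
  have hg0 : g.eval 0 = f.coeff n := by
    rw [← coeff_zero_eq_eval_zero, hg, coeff_reflect, revAt_le (Nat.zero_le n), Nat.sub_zero]
  have hg1 : ‖g.coeff 1‖ = k ^ (n - 1) * ‖P.coeff (n - 1)‖ := by
    rw [hg, coeff_reflect, revAt_le (by omega), hfc, norm_mul, norm_pow, Complex.norm_real,
      Real.norm_of_nonneg hk0.le, mul_comm]
  have hfn : ‖f.coeff n‖ = k ^ n * ‖P.coeff n‖ := by
    rw [hfc, norm_mul, norm_pow, Complex.norm_real, Real.norm_of_nonneg hk0.le, mul_comm]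
  have hf0 : ‖f.coeff 0‖ = ‖P.coeff 0‖ := by rw [hfc]; simp
  have hfnorm : ∀ {z : ℂ}, ‖z‖ = 1 → ‖(k : ℂ) * z‖ = k := fun hz => by
    rw [norm_mul, hz, mul_one, Complex.norm_real, Real.norm_of_nonneg hk0.le]
  have hunit : ∀ {z : ℂ}, ‖z‖ = 1 → z ≠ 0 := fun h => by rintro rfl; simp at h
  have hgnorm : ∀ {z : ℂ}, ‖z‖ = 1 → ‖g.eval z‖ = ‖f.eval z⁻¹‖ := fun hz => by
    rw [hge (hunit hz), norm_mul, norm_pow, hz, one_pow, one_mul]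
  have hinv : ∀ {z : ℂ}, ‖z‖ = 1 → ‖z⁻¹‖ = 1 := fun hz => by rw [norm_inv, hz, inv_one]
  have hgz : ∀ z : ℂ, ‖z‖ < 1 → g.eval z ≠ 0 := fun z hz h => by
    by_cases hz0 : z = 0
    · rw [hz0, hg0, hfc] at h
      exact mul_ne_zero hPn (pow_ne_zero _ hkc) h
    · rw [hge hz0, hfe] at h
      have h1 := hroots _ ((mul_eq_zero.1 h).resolve_left (pow_ne_zero _ hz0))
      rw [norm_mul, Complex.norm_real, Real.norm_of_nonneg hk0.le, norm_inv] at h1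
      have : 1 < ‖z‖⁻¹ := (one_lt_inv₀ (norm_pos_iff.2 hz0)).2 hz
      nlinarith
  have hm0 := circleMin_nonneg P hk0.le
  set m := circleMin P k with hm
  have hgm : ∀ z : ℂ, ‖z‖ ≤ 1 → m ≤ ‖g.eval z‖ := fun z hz =>
    le_norm_eval_of_no_zeros hgz (fun w hw => by
      rw [hgnorm hw, hfe]
      exact circleMin_le_norm_eval P (hfnorm (hinv hw))) hz
  obtain ⟨μ, hμ⟩ : ∃ μ, μ = l * m := ⟨_, rfl⟩
  have hμ0 : 0 ≤ μ := hμ ▸ mul_nonneg hl0 hm0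
  have hμm : μ ≤ m := by rw [hμ]; nlinarith
  -- Strictness comes from zero-freeness if m = 0, and from l < 1 if m > 0.
  have hglt : ∀ z : ℂ, ‖z‖ < 1 → μ < ‖g.eval z‖ := fun z hz => by
    rcases hm0.eq_or_lt with h | h
    · rw [hμ, ← h, mul_zero]
      exact norm_pos_iff.2 (hgz z hz)
    · refine lt_of_lt_of_le ?_ (hgm z hz.le)
      rw [hμ]; nlinarith
  have hgle : ∀ z : ℂ, ‖z‖ = 1 → μ ≤ ‖g.eval z‖ := fun z hz => hμm.trans (hgm z hz.le)
  have hlead : μ < ‖f.coeff n‖ := by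
    rw [← hg0]
    exact hglt 0 (by simp)
  have hffge : ∀ z : ℂ, ‖z‖ = 1 → μ ≤ ‖f.eval z‖ := fun z hz => by
    have := hgle _ (hinv hz)
    rwa [hgnorm (hinv hz), inv_inv] at this
  have hffgt : ∀ z : ℂ, 1 < ‖z‖ → μ * ‖z‖ ^ n < ‖f.eval z‖ := fun z hz => by
    have hz0 : z ≠ 0 := norm_pos_iff.1 (by linarith)
    have h1 := hglt z⁻¹ (by rw [norm_inv]; exact inv_lt_one_of_one_lt₀ hz)
    rw [← eval_reflect_inv_mul_pow hfd hz0, norm_mul, norm_pow]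
    exact mul_lt_mul_of_pos_right h1 (by positivity)
  have hpos : 0 < k ^ n * ‖P.coeff n‖ - l * m := by rw [← hfn, ← hμ]; linarith
  refine ⟨hpos, ?_⟩
  set M' := circleMax P.derivative 1 with hM'
  set M₁ := circleMax P 1 with hM₁
  set Mk := circleMax P k with hMk
  -- the Turán type bound on the circle of radius `k`
  obtain ⟨z₁, hz₁, hPz₁⟩ := exists_norm_eval_eq_circleMax P hk0.le
  have hw : ‖z₁ / k‖ = 1 := by
    rw [norm_div, Complex.norm_real, Real.norm_of_nonneg hk0.le, hz₁, div_self hk0.ne']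
  have hT := half_mul_sub_add_le_norm_derivative hn hfd hμ0 hffgt hffge hlead hw
  have hfder : ‖f.derivative.eval (z₁ / k)‖ = k * ‖P.derivative.eval (k * (z₁ / k))‖ := by
    have : f.derivative.eval (z₁ / k) = k * P.derivative.eval (k * (z₁ / k)) := by
      simp [hf, derivative_comp]
    rw [this, norm_mul, Complex.norm_real, Real.norm_of_nonneg hk0.le]
  have hG := norm_eval_mul_le_psi hn (natDegree_derivative_le_pred hP.le)
    (fun z hz => norm_eval_le_circleMax P.derivative hz) hk hw
  have hcoeff : P.derivative.coeff 0 = P.coeff 1 := by simp [coeff_derivative]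
  rw [hfder, hfe, mul_div_cancel₀ _ hkc, hPz₁, hfn, hf0] at hT
  rw [hcoeff, mul_div_cancel₀ _ hkc] at hG
  -- the Ankeny-Rivlin type bound
  obtain ⟨z₂, hz₂, hPz₂⟩ := exists_norm_eval_eq_circleMax P zero_le_one
  have hA := norm_eval_mul_le_of_no_zeros hn hgd (M := Mk) (fun z hz => by
    rw [hgnorm hz, hfe]
    exact norm_eval_le_circleMax P (hfnorm (hinv hz))) hμ0 hglt hgle hk (hinv hz₂)
  have hgk : ‖g.eval (k * z₂⁻¹)‖ = k ^ n * M₁ := by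
    rw [hge (mul_ne_zero hkc (inv_ne_zero (hunit hz₂))), norm_mul, norm_pow, hfnorm (hinv hz₂), hfe,
      mul_inv, inv_inv, mul_inv_cancel_left₀ hkc, hPz₂]
  have hgMk : ‖g.eval z₂⁻¹‖ ≤ Mk := by
    rw [hgnorm (hinv hz₂), hfe]
    exact norm_eval_le_circleMax P (hfnorm (hinv (hinv hz₂)))
  rw [hgk, hg1] at hA
  -- combination
  have hn' : (2 : ℝ) ≤ n := by exact_mod_cast hn
  have hs := neg_one_le_ratio hpos (norm_nonneg (P.coeff 0))
  rw [hμ] at hT hA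
  rw [derivLowerBound, ← hM₁, ← hm]
  have hsr : coeffRatio n k l P = (k ^ n * ‖P.coeff n‖ - l * m - ‖P.coeff 0‖) /
    (k ^ n * ‖P.coeff n‖ - l * m + ‖P.coeff 0‖) := rfl
  rw [← hsr] at hT hs
  generalize coeffRatio n k l P = s at *
  generalize phi n k = φ at *
  generalize psi n k = ψ at *
  generalize ‖P.coeff (n - 1)‖ = b at *
  generalize ‖P.coeff 1‖ = a at *
  have hkn : k ^ n = k * k ^ (n - 1) := by
    rw [← pow_succ', Nat.sub_add_cancel (by omega)]
  have hK : 0 < k ^ n := by positivity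
  have h1 : 1 / 2 * (n + s) * (Mk - l * m) + n * (l * m) ≤ k ^ n * (M' - ψ * a) := by
    refine hT.trans ?_
    rw [hkn, mul_assoc]
    exact mul_le_mul_of_nonneg_left hG hk0.le
  -- This is `hA` solved for Mk - lm, after bounding |g(z₂⁻¹)| by Mk.
  have h2 : 2 * (k ^ n * M₁ - l * m + k ^ (n - 1) * b * φ) / (1 + k ^ n) ≤ Mk - l * m := by
    rw [div_le_iff₀ (by positivity)]
    linarith
  have h3 : 1 / 2 * (n + s) * (2 * (k ^ n * M₁ - l * m + k ^ (n - 1) * b * φ) / (1 + k ^ n)) ≤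
      1 / 2 * (n + s) * (Mk - l * m) := mul_le_mul_of_nonneg_left h2 (by linarith)
  have h4 : k ^ n * (n / (1 + k ^ n) * (M₁ + l * m) + ψ * a + 1 / (k ^ n * (1 + k ^ n)) *
      (s * (k ^ n * M₁ - l * m) + k ^ (n - 1) * b * φ * (n + s))) =
      1 / 2 * (n + s) * (2 * (k ^ n * M₁ - l * m + k ^ (n - 1) * b * φ) / (1 + k ^ n)) +
        n * (l * m) + k ^ n * (ψ * a) := by
    field_simp
    ring
  refine le_of_mul_le_mul_left ?_ hK
  rw [h4]
  linarith

/-! ### Sharpness -/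

theorem circleMin_eq_zero_of_isRoot {P : ℂ[X]} {z : ℂ} (hz : P.IsRoot z) :
    circleMin P ‖z‖ = 0 := by
  refine le_antisymm ?_ (circleMin_nonneg P (norm_nonneg z))
  have := circleMin_le_norm_eval P (rfl : ‖z‖ = ‖z‖)
  rwa [hz, norm_zero] at this

theorem circleMax_eq_of_le_of_eq {P : ℂ[X]} {M : ℝ} (hM : ∀ z : ℂ, ‖z‖ = 1 → ‖P.eval z‖ ≤ M)
    {z : ℂ} (hz : ‖z‖ = 1) (h : ‖P.eval z‖ = M) : circleMax P 1 = M := by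
  obtain ⟨w, hw, hPw⟩ := exists_norm_eval_eq_circleMax P zero_le_one
  exact le_antisymm (hPw ▸ hM w hw) (h ▸ norm_eval_le_circleMax P hz)

theorem norm_eq_of_isRoot_X_pow_add_C {n : ℕ} (hn : n ≠ 0) {k : ℝ} (hk : 0 ≤ k) {z : ℂ}
    (hz : (X ^ n + C ((k : ℂ) ^ n) : ℂ[X]).IsRoot z) : ‖z‖ = k := by
  have h : z ^ n = -(k : ℂ) ^ n := by
    simpa [IsRoot, add_eq_zero_iff_eq_neg] using hz
  have := congrArg norm h
  rw [norm_neg, norm_pow, norm_pow, Complex.norm_real, Real.norm_of_nonneg hk] at this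
  exact (pow_left_inj₀ (norm_nonneg z) hk hn).1 this

/-- All zeros lie on |z| = k, so m = 0 and l drops out. The ratio vanishes because |a_0| = k^n
|a_n|, and so do a_1 and a_{n-1}; both sides equal n. -/
theorem circleMax_derivative_X_pow_add_C {n : ℕ} (hn : 2 ≤ n) {k : ℝ} (hk : 1 ≤ k) (l : ℝ) :
    circleMax (X ^ n + C ((k : ℂ) ^ n) : ℂ[X]).derivative 1 =
      derivLowerBound n k l (X ^ n + C ((k : ℂ) ^ n) : ℂ[X]) := by
  have hk0 : 0 < k := by linarith
  set P : ℂ[X] := X ^ n + C ((k : ℂ) ^ n) with hP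
  have hdeg : P.natDegree = n := natDegree_X_pow_add_C
  have hmin : circleMin P k = 0 := by
    obtain ⟨z, hz⟩ := IsAlgClosed.exists_root P
      (degree_ne_of_natDegree_ne (n := 0) (by omega))
    have := norm_eq_of_isRoot_X_pow_add_C (by omega) hk0.le hz
    rw [← this]
    exact circleMin_eq_zero_of_isRoot hz
  have hcoeff : ∀ j, j ≠ n → j ≠ 0 → P.coeff j = 0 := fun j h1 h2 => by
    rw [hP, coeff_add, coeff_X_pow, if_neg h1, coeff_C_of_ne_zero h2, add_zero]
  have hPn : P.coeff n = 1 := by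
    rw [hP, coeff_add, coeff_X_pow, if_pos rfl, coeff_C_of_ne_zero (by omega), add_zero]
  have hP0 : P.coeff 0 = (k : ℂ) ^ n := by
    rw [hP, coeff_add, coeff_X_pow, if_neg (by omega), coeff_C_zero, zero_add]
  have hmax : circleMax P 1 = 1 + k ^ n := by
    refine circleMax_eq_of_le_of_eq (z := 1) (fun z hz => ?_) (by simp) ?_
    · simp only [hP, eval_add, eval_pow, eval_X, eval_C]
      refine (norm_add_le _ _).trans ?_
      simp [hz, abs_of_pos hk0]
    · have : P.eval 1 = ((1 + k ^ n : ℝ) : ℂ) := by simp [hP]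
      rw [this, Complex.norm_real, Real.norm_of_nonneg (by positivity)]
  have hPd : P.derivative = C (n : ℂ) * X ^ (n - 1) := by
    rw [hP, derivative_add, derivative_C, add_zero, derivative_X_pow]
  have hder : circleMax P.derivative 1 = n :=
    circleMax_eq_of_le_of_eq (z := 1) (fun z hz => by simp [hPd, hz]) (by simp) (by simp [hPd])
  have hratio : coeffRatio n k l P = 0 := by
    simp [coeffRatio, hmin, hPn, hP0, abs_of_pos hk0]
  rw [hder, derivLowerBound, hratio, hmax, hmin, hcoeff 1 (by omega) (by omega),
    hcoeff (n - 1) (by omega) (by omega)]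
  have : 0 < 1 + k ^ n := by positivity
  simp only [norm_zero, mul_zero, zero_mul, add_zero]
  field_simp

theorem theorem2 (n : ℕ) (hn : 2 ≤ n) (k : ℝ) (hk : 1 ≤ k) :
    -- the inequality, for every admissible polynomial and every `0 ≤ l < 1`
    (∀ P : ℂ[X], P.natDegree = n → (∀ z : ℂ, P.IsRoot z → ‖z‖ ≤ k) →
      (∀ l : ℝ, 0 ≤ l → l < 1 →
        0 < k ^ n * ‖P.coeff n‖ - l * circleMin P k + ‖P.coeff 0‖ ∧
        derivLowerBound n k l P ≤ circleMax P.derivative 1) ∧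
      -- it contains, as the case `l = 0`, the bound without the minimum modulus
      derivLowerBound n k 0 P =
        1 / (1 + k ^ n) *
            ((n : ℝ) + (k ^ n * ‖P.coeff n‖ - ‖P.coeff 0‖) / (k ^ n * ‖P.coeff n‖ + ‖P.coeff 0‖)) *
            circleMax P 1
          + ‖P.coeff (n - 1)‖ / (k * (1 + k ^ n)) *
            ((n : ℝ) + (k ^ n * ‖P.coeff n‖ - ‖P.coeff 0‖) / (k ^ n * ‖P.coeff n‖ + ‖P.coeff 0‖)) *
            phi n k
          + ‖P.coeff 1‖ * psi n k) ∧
    -- sharpness: `z ^ n + k ^ n` is admissible and gives equality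
    ((X ^ n + C ((k : ℂ) ^ n) : ℂ[X]).natDegree = n ∧
      (∀ z : ℂ, (X ^ n + C ((k : ℂ) ^ n) : ℂ[X]).IsRoot z → ‖z‖ ≤ k) ∧
      ∀ l : ℝ, 0 ≤ l → l < 1 →
        circleMax (X ^ n + C ((k : ℂ) ^ n) : ℂ[X]).derivative 1 =
          derivLowerBound n k l (X ^ n + C ((k : ℂ) ^ n) : ℂ[X])) := by
  refine ⟨fun P hP hroots => ⟨fun l hl0 hl1 => ?_, ?_⟩, natDegree_X_pow_add_C, fun z hz =>
    (norm_eq_of_isRoot_X_pow_add_C (by omega) (by linarith) hz).le,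
    fun l _ _ => circleMax_derivative_X_pow_add_C hn hk l⟩
  · obtain ⟨h1, h2⟩ := derivLowerBound_le_circleMax hn hk hP hroots hl0 hl1
    exact ⟨add_pos_of_pos_of_nonneg h1 (norm_nonneg _), h2⟩
  · have hkn : k ^ n = k * k ^ (n - 1) := by
      rw [← pow_succ', Nat.sub_add_cancel (by omega)]
    have hk1 : 0 < k ^ (n - 1) := by positivity
    have hd : 0 < 1 + k * k ^ (n - 1) := by positivity
    rw [derivLowerBound, coeffRatio, zero_mul, sub_zero, sub_zero, add_zero]
    generalize (k ^ n * ‖P.coeff n‖ - ‖P.coeff 0‖) / (k ^ n * ‖P.coeff n‖ + ‖P.coeff 0‖) = s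
    rw [hkn]
    field_simp
    ring
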